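/- Let $(\Omega,\mathcal F,\mathbb P)$ be a probability space and let $X=(X(t))_{t\in\mathbb R}$ be a real-valued, jointly measurable process with stationary increments, i.e. for every $j\in\mathbb R$ the process $\delta_jX(t)=X(t)-X(t-2^j)$ is stationary. Let $\psi:\mathbb R\to\mathbb C$ be a wavelet: $\int(1+|t|)\,|\psi(t)|\,dt<\infty$ and $\int\psi(t)\,dt=0$. Assume that $\psi$ has only positive frequencies: $\widehat\psi(\omega)=\int\psi(t)e^{-i\omega t}\,dt=0$ for $\omega<0$. For $j\in\mathbb Z$ put $\psi_j(t)=2^{-j}\psi(2^{-j}t)$ and $WX(t,j)=X\star\psi_j(t)=\int X(u)\,\psi_j(t-u)\,du$. Let $\rho(z)=(z,|z|)$ for $z\in\mathbb C$, and for random vectors $A,B$ with values in $\mathbb C^2$ let $\mathrm{Cov}\{A,B\}$ be the $2\times2$ matrix with entries $\mathbb E\{A_pB_q^*\}-\mathbb E\{A_p\}\,\mathbb E\{B_q\}^*$. Let $j,a\in\mathbb Z$ be such that $\widehat\psi_j(\omega)\,\widehat\psi_{j-a}(\omega)=0$ for all $\omega\in\mathbb R$. If $X$ is a Gaussian process, then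 for all $t\in\mathbb R$ and $k\in\mathbb Z$ the integral defining $WX(t,k)$ converges absolutely almost surely and $WX(t,k)$ has a finite second moment, and for all $t,\tau\in\mathbb R$ $$\mathrm{Cov}\{\rho WX(t,j),\ \rho WX(t-2^j\tau,\,j-a)\}=0 .$$ Consequently, if some entry of this covariance matrix is non-zero for some $t,\tau\in\mathbb R$, then $X$ is not Gaussian. -/

import Mathlib

open MeasureTheory ProbabilityTheory
open scoped ComplexConjugate

noncomputable section

namespace WaveletCov

/-- The Fourier transform `f̂(ω) = ∫ f(t) e^{-iωt} dt` (angular frequency). -/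
def hat (f : ℝ → ℂ) (ω : ℝ) : ℂ :=
  ∫ t : ℝ, f t * Complex.exp (-Complex.I * (ω : ℂ) * (t : ℂ))

/-- A wavelet: a function with zero average that decays fast enough for `(1 + |t|) ψ(t)` to be
integrable. This is the decay under which the wavelet transform of a process with stationary
increments, which may grow linearly, is defined. -/
structure IsWavelet (ψ : ℝ → ℂ) : Prop where
  decay : Integrable (fun t : ℝ => ((1 + |t| : ℝ) : ℂ) * ψ t)
  zero_average : ∫ t : ℝ, ψ t = 0

/-- The wavelet only has positive frequencies: `ψ̂(ω) = 0` for `ω < 0`. -/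
def PositiveFrequencies (ψ : ℝ → ℂ) : Prop :=
  ∀ ω : ℝ, ω < 0 → hat ψ ω = 0

/-- The dilated wavelet `ψ_j(t) = 2^{-j} ψ(2^{-j} t)`. -/
def dilate (ψ : ℝ → ℂ) (j : ℤ) (t : ℝ) : ℂ :=
  (((2 : ℝ) ^ (-j) : ℝ) : ℂ) * ψ ((2 : ℝ) ^ (-j) * t)

/-- The wavelet transform `W x(t, j) = x ⋆ ψ_j (t) = ∫ x(u) ψ_j(t - u) du` of a signal `x`. -/
def waveletTransform (ψ : ℝ → ℂ) (x : ℝ → ℝ) (t : ℝ) (j : ℤ) : ℂ :=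
  ∫ u : ℝ, (x u : ℂ) * dilate ψ j (t - u)

/-- `ρ(z) = (z, |z|)`. -/
def rho (z : ℂ) : Fin 2 → ℂ := ![z, (‖z‖ : ℂ)]

section Defs

variable {Ω : Type*} [MeasurableSpace Ω]

/-- The increments `δ_j X(t) = X(t) - X(t - 2^j)`, for real `j`. -/
def increment (X : ℝ → Ω → ℝ) (j : ℝ) (t : ℝ) (ω : Ω) : ℝ :=
  X t ω - X (t - (2 : ℝ) ^ j) ω

/-- (Strict) stationarity: all finite-dimensional laws are invariant under time shifts. -/
def IsStationary (Y : ℝ → Ω → ℝ) (P : Measure Ω) : Prop :=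
  ∀ (h : ℝ) (I : Finset ℝ),
    P.map (fun ω => I.restrict (fun t => Y (t + h) ω)) =
      P.map (fun ω => I.restrict (fun t => Y t ω))

/-- `X` has stationary increments: `δ_j X` is stationary for every real `j`. -/
def HasStationaryIncrements (X : ℝ → Ω → ℝ) (P : Measure Ω) : Prop :=
  ∀ j : ℝ, IsStationary (increment X j) P

/-- The random vector `ρ W X(t, j)`. -/
def rhoW (ψ : ℝ → ℂ) (X : ℝ → Ω → ℝ) (t : ℝ) (j : ℤ) (ω : Ω) : Fin 2 → ℂ :=
  rho (waveletTransform ψ (fun u => X u ω) t j)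

/-- The covariance `Cov{A, B} = E{A B^*} - E{A} E{B}^*` of two random vectors with values in `ℂ²`,
a `2 × 2` matrix. -/
def covMatrix (P : Measure Ω) (A B : Ω → Fin 2 → ℂ) : Matrix (Fin 2) (Fin 2) ℂ :=
  Matrix.of fun p q =>
    (∫ ω, A ω p * conj (B ω q) ∂P) - (∫ ω, A ω p ∂P) * conj (∫ ω, B ω q ∂P)

end Defs

end WaveletCov

end

/-!
A zero-average wavelet does not see the constant `X 0`, so `X` may be replaced by `X - X 0`, whose
increments have the laws of the process itself. If `σ u` is its standard deviation, polarization
gives the covariance kernel `(σ u ^ 2 + σ v ^ 2 - σ (u - v) ^ 2) / 2`. Against two weights with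
zero average the first two terms vanish, and the third is a convolution kernel, which vanishes
when the spectra of the weights do not meet. As `σ` is a group seminorm, it grows at most
linearly and dominates the kernel by `σ u * σ v`, so the double integral converges absolutely and
`σ` can be truncated before passing to Fourier transforms.

The two wavelets have disjoint spectra by assumption, and each has a spectrum disjoint from that of
the conjugate of the other because their frequencies are positive. Hence all real-linear functionals
of the two coefficients are uncorrelated. The coefficients are jointly Gaussian, being limits of
linear combinations of the `X u`, so they are independent, and `ρ` preserves independence.
-/

namespace WaveletCov

open Filter Topology Set
open scoped ENNReal NNReal FourierTransform Convolution

section GroupSeminorm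

variable {G : Type*}

/-- The covariance function of a process with stationary increments that starts at zero and whose
value at `u` has standard deviation `σ u`. -/
noncomputable def incrementKernel [AddGroup G] (σ : AddGroupSeminorm G) (u v : G) : ℝ :=
  (σ u ^ 2 + σ v ^ 2 - σ (u - v) ^ 2) / 2

lemma abs_incrementKernel_le [AddGroup G] (σ : AddGroupSeminorm G) (u v : G) :
    |incrementKernel σ u v| ≤ σ u * σ v := by
  have h_upper : σ (u - v) ^ 2 ≤ (σ u + σ v) ^ 2 :=
    pow_le_pow_left₀ (apply_nonneg σ _) (map_sub_le_add σ u v) 2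
  have h_lower : (σ u - σ v) ^ 2 ≤ σ (u - v) ^ 2 :=
    sq_le_sq.2 ((abs_sub_map_le_sub σ u v).trans (le_abs_self _))
  rw [incrementKernel, abs_le]
  constructor <;> linarith [add_sq (σ u) (σ v), sub_sq (σ u) (σ v)]

lemma measurable_incrementKernel [AddGroup G] [MeasurableSpace G] [MeasurableSub₂ G]
    {σ : AddGroupSeminorm G} (hσ : Measurable σ) :
    Measurable fun z : G × G => incrementKernel σ z.1 z.2 := by
  unfold incrementKernel
  fun_prop

lemma norm_incrementKernel_mul_le [AddGroup G] (σ : AddGroupSeminorm G) (p r : G → ℂ)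
    (z : G × G) :
    ‖(incrementKernel σ z.1 z.2 : ℂ) * (p z.1 * r z.2)‖ ≤
      ‖(σ z.1 : ℂ) * p z.1‖ * ‖(σ z.2 : ℂ) * r z.2‖ := by
  simp only [norm_mul, Complex.norm_real, Real.norm_eq_abs, abs_of_nonneg (apply_nonneg σ _)]
  calc |incrementKernel σ z.1 z.2| * (‖p z.1‖ * ‖r z.2‖)
      ≤ σ z.1 * σ z.2 * (‖p z.1‖ * ‖r z.2‖) := by
        gcongr
        exact abs_incrementKernel_le σ z.1 z.2
    _ = σ z.1 * ‖p z.1‖ * (σ z.2 * ‖r z.2‖) := mul_mul_mul_comm _ _ _ _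

/-- The pointwise minimum of a group seminorm with a constant. It is again a group seminorm, so
every estimate that only uses the triangle inequality survives truncation. -/
def truncate [AddGroup G] (σ : AddGroupSeminorm G) (N : ℝ≥0) : AddGroupSeminorm G where
  toFun u := min (σ u) N
  map_zero' := by simp
  add_le' u v := by
    have hu := apply_nonneg σ u
    have hv := apply_nonneg σ v
    rcases le_total (σ u) N with h | h <;> rcases le_total (σ v) N with h' | h' <;>
      simp only [min_eq_left, min_eq_right, h, h', min_le_iff] <;>
      grind [map_add_le_add σ u v, N.coe_nonneg]
  neg' u := by rw [map_neg_eq_map]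

lemma tendsto_incrementKernel_truncate [AddGroup G] (σ : AddGroupSeminorm G) (u v : G) :
    Tendsto (fun N : ℕ => incrementKernel (truncate σ N) u v) atTop
      (𝓝 (incrementKernel σ u v)) := by
  have h_eventually (w : G) : ∀ᶠ N : ℕ in atTop, truncate σ N w = σ w := by
    filter_upwards [eventually_ge_atTop ⌈σ w⌉₊] with N hN
    exact min_eq_left (Nat.ceil_le.1 hN)
  refine tendsto_nhds_of_eventually_eq ?_
  filter_upwards [h_eventually u, h_eventually v, h_eventually (u - v)] with N hu hv huv
  simp only [incrementKernel, hu, hv, huv]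

lemma map_nsmul_le [AddGroup G] (σ : AddGroupSeminorm G) (n : ℕ) (u : G) :
    σ (n • u) ≤ n * σ u := by
  induction n with
  | zero => simp
  | succ n ih =>
    rw [succ_nsmul, Nat.cast_succ, add_one_mul]
    exact (map_add_le_add σ _ _).trans (by gcongr)

lemma exists_eventually_le_nhds_zero [AddGroup G] [TopologicalSpace G] [IsTopologicalAddGroup G]
    [LocallyCompactSpace G] [MeasurableSpace G] [BorelSpace G] (σ : AddGroupSeminorm G)
    (hσ : Measurable σ) : ∃ M : ℝ, ∀ᶠ u in 𝓝 0, σ u ≤ M := by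
  let K : TopologicalSpace.PositiveCompacts G := Classical.arbitrary _
  obtain ⟨n, hn⟩ : ∃ n : ℕ, 0 < Measure.addHaar (interior (K : Set G) ∩ {u | σ u ≤ n}) := by
    by_contra! h
    simp_rw [nonpos_iff_eq_zero, ← measure_iUnion_null_iff, ← inter_iUnion] at h
    have h_union : ⋃ n : ℕ, {u | σ u ≤ n} = univ :=
      eq_univ_of_forall fun u => mem_iUnion.2 (exists_nat_ge (σ u))
    rw [h_union, inter_univ] at h
    exact (isOpen_interior.measure_pos _ K.interior_nonempty).ne' h
  have h_sublevel : MeasurableSet (interior (K : Set G) ∩ {u | σ u ≤ n}) :=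
    isOpen_interior.measurableSet.inter (measurableSet_le hσ measurable_const)
  have h_finite : Measure.addHaar (interior (K : Set G) ∩ {u | σ u ≤ n}) ≠ ∞ :=
    measure_ne_top_of_subset (inter_subset_left.trans interior_subset)
      K.isCompact.measure_ne_top
  refine ⟨n + n, ?_⟩
  filter_upwards [Measure.sub_mem_nhds_zero_of_addHaar_pos_ne_top _ _ h_sublevel hn h_finite]
  rintro _ ⟨v, ⟨-, hv⟩, w, ⟨-, hw⟩, rfl⟩
  exact (map_sub_le_add σ v w).trans (add_le_add hv hw)

lemma exists_le_mul_one_add_norm_of_eventually_le [NormedAddCommGroup G] [NormedSpace ℝ G]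
    (σ : AddGroupSeminorm G) {M : ℝ} (hM : ∀ᶠ u in 𝓝 0, σ u ≤ M) :
    ∃ C, ∀ u, σ u ≤ C * (1 + ‖u‖) := by
  obtain ⟨ε, hε, hball⟩ := Metric.eventually_nhds_iff_ball.1 hM
  have hM0 : 0 ≤ M := (apply_nonneg σ 0).trans (hball 0 (Metric.mem_ball_self hε))
  refine ⟨M * (1 + ε⁻¹), fun u => ?_⟩
  set k : ℕ := ⌊‖u‖ / ε⌋₊ + 1
  have hk : (0 : ℝ) < k := by positivity
  have hk_gt : ‖u‖ / ε < k := by simpa [k] using Nat.lt_floor_add_one (‖u‖ / ε)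
  have hk_le : (k : ℝ) ≤ ‖u‖ / ε + 1 := by
    simpa [k] using Nat.floor_le (show 0 ≤ ‖u‖ / ε by positivity)
  have h_small : (k : ℝ)⁻¹ • u ∈ Metric.ball 0 ε := by
    rw [mem_ball_zero_iff, norm_smul, norm_inv, Real.norm_of_nonneg hk.le, inv_mul_lt_iff₀ hk]
    rwa [div_lt_iff₀ hε] at hk_gt
  calc σ u = σ (k • (k : ℝ)⁻¹ • u) := by
        rw [← Nat.cast_smul_eq_nsmul ℝ, smul_inv_smul₀ hk.ne']
    _ ≤ k * M := (map_nsmul_le σ k _).trans (by gcongr; exact hball _ h_small)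
    _ ≤ (‖u‖ / ε + 1) * M := by gcongr
    _ ≤ M * (1 + ε⁻¹) * (1 + ‖u‖) := by
        rw [mul_comm, mul_assoc, div_eq_mul_inv]
        gcongr
        nlinarith [norm_nonneg u, inv_pos.2 hε]

lemma exists_le_mul_one_add_norm [NormedAddCommGroup G] [NormedSpace ℝ G] [FiniteDimensional ℝ G]
    [MeasurableSpace G] [BorelSpace G] (σ : AddGroupSeminorm G) (hσ : Measurable σ) :
    ∃ C, ∀ u, σ u ≤ C * (1 + ‖u‖) := by
  have : ProperSpace G := FiniteDimensional.proper_real G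
  obtain ⟨M, hM⟩ := exists_eventually_le_nhds_zero σ hσ
  exact exists_le_mul_one_add_norm_of_eventually_le σ hM

end GroupSeminorm

section FourierTransform

variable {V : Type*} [NormedAddCommGroup V] [InnerProductSpace ℝ V] [FiniteDimensional ℝ V]
  [MeasurableSpace V] [BorelSpace V]

lemma integral_fourier_mul_schwartz_eq {f : V → ℂ} (hf : Integrable f) (g : SchwartzMap V ℂ) :
    ∫ ξ, 𝓕 f ξ * g ξ = ∫ x, f x * 𝓕 g x := by
  rw [SchwartzMap.fourier_coe]
  have h_flip := VectorFourier.integral_fourierIntegral_smul_eq_flip (μ := volume) (ν := volume)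
    (L := innerₗ V) (g := g) Real.continuous_fourierChar continuous_inner hf g.integrable
  rwa [flip_innerₗ] at h_flip

theorem ae_eq_zero_of_fourier_eq_zero {f : V → ℂ} (hf : Integrable f) (h : ∀ ξ, 𝓕 f ξ = 0) :
    f =ᵐ[volume] 0 := by
  refine ae_eq_zero_of_integral_contDiff_smul_eq_zero hf.locallyIntegrable fun g hg hg_supp => ?_
  have hG_supp : HasCompactSupport (Complex.ofRealCLM ∘ g) := hg_supp.comp_left rfl
  let G : SchwartzMap V ℂ := hG_supp.toSchwartzMap (by fun_prop)
  calc ∫ x, g x • f x = ∫ x, f x * 𝓕 (𝓕⁻ G) x := by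
        simp [FourierTransform.fourier_fourierInv_eq, G, mul_comm]
    _ = ∫ ξ, 𝓕 f ξ * 𝓕⁻ G ξ := (integral_fourier_mul_schwartz_eq hf _).symm
    _ = 0 := by simp [h]

lemma integral_mul_convolution {b f g : V → ℂ} (hb : Measurable b) {M : ℝ} (hM : ∀ w, ‖b w‖ ≤ M)
    (hf : Integrable f) (hg : Integrable g) :
    ∫ w, b w * (f ⋆[ContinuousLinearMap.mul ℂ ℂ] g) w =
      ∫ z : V × V, b (z.1 + z.2) * (f z.1 * g z.2) := by
  have h_shear : Integrable fun z : V × V => b z.1 * (f z.2 * g (z.1 - z.2)) :=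
    (hf.convolution_integrand (ContinuousLinearMap.mul ℂ ℂ) hg).bdd_mul
      (hb.comp measurable_fst).aestronglyMeasurable (ae_of_all _ fun z => hM z.1)
  have h_prod : Integrable fun z : V × V => b (z.1 + z.2) * (f z.1 * g z.2) :=
    (hf.mul_prod hg).bdd_mul
      (hb.comp (measurable_fst.add measurable_snd)).aestronglyMeasurable
      (ae_of_all _ fun z => hM _)
  calc ∫ w, b w * (f ⋆[ContinuousLinearMap.mul ℂ ℂ] g) w
      = ∫ w, ∫ t, b w * (f t * g (w - t)) := by
        simp only [convolution_def, ContinuousLinearMap.mul_apply', integral_const_mul]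
    _ = ∫ t, ∫ w, b w * (f t * g (w - t)) := integral_integral_swap h_shear
    _ = ∫ t, ∫ s, b (t + s) * (f t * g s) := by
        congr with t
        rw [← integral_add_left_eq_self _ t]
        simp only [add_sub_cancel_left]
    _ = ∫ z : V × V, b (z.1 + z.2) * (f z.1 * g z.2) := (integral_prod _ h_prod).symm

/-- For a bounded stationary kernel `b`, the double integral is `∫ b * (p ⋆ r(-·))`, and the
spectral condition says that this convolution has Fourier transform zero. -/
theorem integral_sub_mul_eq_zero {b p r : V → ℂ} (hb : Measurable b) {M : ℝ} (hM : ∀ w, ‖b w‖ ≤ M)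
    (hp : Integrable p) (hr : Integrable r) (h : ∀ ξ, 𝓕 p ξ * 𝓕 r (-ξ) = 0) :
    ∫ z : V × V, b (z.1 - z.2) * (p z.1 * r z.2) = 0 := by
  have hr_neg : Integrable fun v => r (-v) := hr.comp_neg
  have h_fourier_neg : ∀ ξ, 𝓕 (fun v => r (-v)) ξ = 𝓕 r (-ξ) := fun ξ => by
    rw [Real.fourier_eq, Real.fourier_eq, ← integral_neg_eq_self]
    simp only [neg_neg, inner_neg_left, inner_neg_right]
  have h_conv : p ⋆[ContinuousLinearMap.mul ℂ ℂ] (fun v => r (-v)) =ᵐ[volume] 0 :=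
    ae_eq_zero_of_fourier_eq_zero (hp.integrable_convolution _ hr_neg) fun ξ => by
      rw [Real.fourier_mul_convolution_eq hp hr_neg, h_fourier_neg, h]
  have h_reflect : MeasurePreserving (Prod.map id Neg.neg : V × V → V × V) :=
    (MeasurePreserving.id volume).prod (Measure.measurePreserving_neg volume)
  calc ∫ z : V × V, b (z.1 - z.2) * (p z.1 * r z.2)
      = ∫ z : V × V, b (z.1 + z.2) * (p z.1 * r (-z.2)) := by
        rw [← h_reflect.integral_comp
          ((MeasurableEquiv.refl V).prodCongr (MeasurableEquiv.neg V)).measurableEmbedding]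
        simp [sub_eq_add_neg]
    _ = ∫ w, b w * (p ⋆[ContinuousLinearMap.mul ℂ ℂ] fun v => r (-v)) w :=
        (integral_mul_convolution hb hM hp hr_neg).symm
    _ = 0 := integral_eq_zero_of_ae <| by filter_upwards [h_conv] with w hw; simp [hw]

end FourierTransform

section IncrementKernel

variable {V : Type*} [NormedAddCommGroup V] [InnerProductSpace ℝ V] [FiniteDimensional ℝ V]
  [MeasurableSpace V] [BorelSpace V] {σ : AddGroupSeminorm V} {p r : V → ℂ}

lemma integrable_incrementKernel_mul (hσ : Measurable σ) (hp : AEStronglyMeasurable p)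
    (hr : AEStronglyMeasurable r) (hσp : Integrable fun u => (σ u : ℂ) * p u)
    (hσr : Integrable fun v => (σ v : ℂ) * r v) :
    Integrable fun z : V × V => (incrementKernel σ z.1 z.2 : ℂ) * (p z.1 * r z.2) :=
  (hσp.norm.mul_prod hσr.norm).mono'
    ((Complex.measurable_ofReal.comp (measurable_incrementKernel hσ)).aestronglyMeasurable.mul
      (hp.comp_fst.mul hr.comp_snd))
    (ae_of_all _ (norm_incrementKernel_mul_le σ p r))

lemma integral_incrementKernel_mul_eq_zero_of_bounded (hσ : Measurable σ) {M : ℝ}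
    (hM : ∀ u, σ u ≤ M) (hp : Integrable p) (hr : Integrable r) (hp_mean : ∫ u, p u = 0)
    (hr_mean : ∫ v, r v = 0) (h : ∀ ξ, 𝓕 p ξ * 𝓕 r (-ξ) = 0) :
    ∫ z : V × V, (incrementKernel σ z.1 z.2 : ℂ) * (p z.1 * r z.2) = 0 := by
  have hb_meas : Measurable fun w => ((σ w ^ 2 / 2 : ℝ) : ℂ) := by fun_prop
  have hb_le (w : V) : ‖((σ w ^ 2 / 2 : ℝ) : ℂ)‖ ≤ M ^ 2 / 2 := by
    rw [Complex.norm_real, Real.norm_of_nonneg (by positivity)]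
    gcongr
    exact hM w
  have h_int {φ : V × V → V} (hφ : Measurable φ) :
      Integrable fun z => ((σ (φ z) ^ 2 / 2 : ℝ) : ℂ) * (p z.1 * r z.2) :=
    (hp.mul_prod hr).bdd_mul (hb_meas.comp hφ).aestronglyMeasurable
      (ae_of_all _ fun z => hb_le (φ z))
  have h_fst : ∫ z : V × V, ((σ z.1 ^ 2 / 2 : ℝ) : ℂ) * (p z.1 * r z.2) = 0 := by
    simp_rw [← mul_assoc, Measure.volume_eq_prod]
    rw [integral_prod_mul (fun u => ((σ u ^ 2 / 2 : ℝ) : ℂ) * p u) r, hr_mean, mul_zero]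
  have h_snd : ∫ z : V × V, ((σ z.2 ^ 2 / 2 : ℝ) : ℂ) * (p z.1 * r z.2) = 0 := by
    simp_rw [mul_left_comm _ (p _), Measure.volume_eq_prod]
    rw [integral_prod_mul p (fun v => ((σ v ^ 2 / 2 : ℝ) : ℂ) * r v), hp_mean, zero_mul]
  have h_sub := integral_sub_mul_eq_zero hb_meas hb_le hp hr h
  calc ∫ z : V × V, (incrementKernel σ z.1 z.2 : ℂ) * (p z.1 * r z.2)
      = ∫ z : V × V, (((σ z.1 ^ 2 / 2 : ℝ) : ℂ) * (p z.1 * r z.2)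
          + ((σ z.2 ^ 2 / 2 : ℝ) : ℂ) * (p z.1 * r z.2))
          - ((σ (z.1 - z.2) ^ 2 / 2 : ℝ) : ℂ) * (p z.1 * r z.2) := by
        congr with z
        rw [incrementKernel]
        push_cast
        ring
    _ = 0 := by
        rw [integral_sub ((h_int measurable_fst).fun_add (h_int measurable_snd))
          (h_int (φ := fun z => z.1 - z.2) (by fun_prop)),
          integral_add (h_int measurable_fst) (h_int measurable_snd), h_fst, h_snd, h_sub]
        simp

/-- Truncating the seminorm reduces to the bounded case; the bound `σ u * σ v` on the kernel holds
uniformly in the truncation level, which is what makes dominated convergence applicable. -/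
theorem integral_incrementKernel_mul_eq_zero (hσ : Measurable σ) (hp : Integrable p)
    (hr : Integrable r) (hσp : Integrable fun u => (σ u : ℂ) * p u)
    (hσr : Integrable fun v => (σ v : ℂ) * r v) (hp_mean : ∫ u, p u = 0)
    (hr_mean : ∫ v, r v = 0) (h : ∀ ξ, 𝓕 p ξ * 𝓕 r (-ξ) = 0) :
    ∫ z : V × V, (incrementKernel σ z.1 z.2 : ℂ) * (p z.1 * r z.2) = 0 := by
  have h_meas (N : ℕ) : Measurable (truncate σ N) := hσ.min measurable_const
  have h_truncate_le (N : ℕ) (q : V → ℂ) (w : V) :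
      ‖(truncate σ N w : ℂ) * q w‖ ≤ ‖(σ w : ℂ) * q w‖ := by
    simp only [norm_mul, Complex.norm_real,
      Real.norm_of_nonneg (apply_nonneg (truncate σ N) w), Real.norm_of_nonneg (apply_nonneg σ w)]
    gcongr
    exact min_le_left _ _
  refine tendsto_nhds_unique ?_ (tendsto_const_nhds (x := (0 : ℂ)) (f := (atTop : Filter ℕ)))
  have h_zero (N : ℕ) := integral_incrementKernel_mul_eq_zero_of_bounded (h_meas N)
    (fun u => min_le_right (σ u) N) hp hr hp_mean hr_mean h
  rw [← funext h_zero]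
  refine tendsto_integral_of_dominated_convergence _ (fun N => ?_)
    (hσp.norm.mul_prod hσr.norm) (fun N => ae_of_all _ fun z => ?_) (ae_of_all _ fun z => ?_)
  · exact (Complex.measurable_ofReal.comp
      (measurable_incrementKernel (h_meas N))).aestronglyMeasurable.mul
        (hp.1.comp_fst.mul hr.1.comp_snd)
  · exact (norm_incrementKernel_mul_le _ p r z).trans
      (mul_le_mul (h_truncate_le N p z.1) (h_truncate_le N r z.2) (norm_nonneg _) (norm_nonneg _))
  · exact ((Complex.continuous_ofReal.tendsto _).comp
      (tendsto_incrementKernel_truncate σ z.1 z.2)).mul_const _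

end IncrementKernel

section MeanSquareIntegral

variable {T Ω : Type*} [MeasurableSpace T] [MeasurableSpace Ω] {ν : Measure T} {P : Measure Ω}

lemma lintegral_mul_le_eLpNorm_two_mul_eLpNorm_two {F G : Ω → ℝ≥0∞} (hF : AEMeasurable F P)
    (hG : AEMeasurable G P) : ∫⁻ ω, F ω * G ω ∂P ≤ eLpNorm F 2 P * eLpNorm G 2 P := by
  simpa [eLpNorm_eq_lintegral_rpow_enorm_toReal two_ne_zero ENNReal.ofNat_ne_top] using
    ENNReal.lintegral_mul_le_Lp_mul_Lq P Real.HolderConjugate.two_two hF hG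

lemma eLpNorm_two_sq (F : Ω → ℝ≥0∞) : eLpNorm F 2 P ^ 2 = ∫⁻ ω, F ω * F ω ∂P := by
  rw [← ENNReal.rpow_natCast,
    eLpNorm_eq_lintegral_rpow_enorm_toReal two_ne_zero ENNReal.ofNat_ne_top, ← ENNReal.rpow_mul]
  simp [pow_two]

/-- Minkowski's integral inequality, by expanding the square of the inner integral into a double
integral and applying the Cauchy–Schwarz inequality inside. -/
theorem eLpNorm_two_lintegral_le [SFinite ν] [SFinite P] {F : T → Ω → ℝ≥0∞}
    (hF : AEMeasurable (Function.uncurry F) (ν.prod P)) :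
    eLpNorm (fun ω => ∫⁻ u, F u ω ∂ν) 2 P ≤ ∫⁻ u, eLpNorm (F u) 2 P ∂ν := by
  have hF_section : ∀ᵐ u ∂ν, AEMeasurable (F u) P :=
    hF.aestronglyMeasurable.prodMk_left.mono fun u hu => hu.aemeasurable
  have hF_swap : AEMeasurable (fun z : Ω × T => F z.2 z.1) (P.prod ν) := hF.prod_swap
  have hF_path : ∀ᵐ ω ∂P, AEMeasurable (fun u => F u ω) ν :=
    hF_swap.aestronglyMeasurable.prodMk_left.mono fun ω hω => hω.aemeasurable
  have h_fubini {G : Ω → ℝ≥0∞} (hG : AEMeasurable G P) :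
      ∫⁻ ω, G ω * ∫⁻ u, F u ω ∂ν ∂P = ∫⁻ u, ∫⁻ ω, G ω * F u ω ∂P ∂ν := by
    rw [← lintegral_lintegral_swap (hG.comp_fst.mul hF_swap)]
    refine lintegral_congr_ae ?_
    filter_upwards [hF_path] with ω hω
    exact (lintegral_const_mul'' _ hω).symm
  have hF_eLpNorm : AEMeasurable (fun u => eLpNorm (F u) 2 P) ν := by
    simp only [eLpNorm_eq_lintegral_rpow_enorm_toReal two_ne_zero ENNReal.ofNat_ne_top]
    exact (hF.enorm.pow_const _).lintegral_prod_right'.pow_const _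
  have h_section_le : ∀ᵐ u ∂ν, ∫⁻ ω, (∫⁻ v, F v ω ∂ν) * F u ω ∂P ≤
      eLpNorm (F u) 2 P * ∫⁻ v, eLpNorm (F v) 2 P ∂ν := by
    filter_upwards [hF_section] with u hu
    simp_rw [mul_comm _ (F u _)]
    rw [h_fubini hu, ← lintegral_const_mul'' _ hF_eLpNorm]
    refine lintegral_mono_ae ?_
    filter_upwards [hF_section] with v hv
    exact lintegral_mul_le_eLpNorm_two_mul_eLpNorm_two hu hv
  refine (ENNReal.pow_le_pow_left_iff two_ne_zero).1 ?_
  calc eLpNorm (fun ω => ∫⁻ u, F u ω ∂ν) 2 P ^ 2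
      = ∫⁻ u, ∫⁻ ω, (∫⁻ v, F v ω ∂ν) * F u ω ∂P ∂ν := by
        rw [eLpNorm_two_sq, h_fubini hF_swap.lintegral_prod_right']
    _ ≤ ∫⁻ u, eLpNorm (F u) 2 P * ∫⁻ v, eLpNorm (F v) 2 P ∂ν ∂ν := lintegral_mono_ae h_section_le
    _ = (∫⁻ u, eLpNorm (F u) 2 P ∂ν) ^ 2 := by
        rw [lintegral_mul_const'' _ hF_eLpNorm, sq]

variable {E F : Type*} [NormedAddCommGroup E] [NormedSpace ℝ E] [NormedAddCommGroup F]
  [NormedSpace ℝ F] {X : T → Ω → ℝ} {f : T → E}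

/-- The integral of a vector-valued weight `f` against the paths of a real process `X`. -/
noncomputable def pathIntegral (ν : Measure T) (X : T → Ω → ℝ) (f : T → E) (ω : Ω) : E :=
  ∫ u, X u ω • f u ∂ν

/-- The condition `∫ ‖X u‖₂ ‖f u‖ dν(u) < ∞` on a square integrable process `X`, under which its
path integral against `f` converges absolutely almost surely and in `L²`. -/
structure MeanSquareIntegrable (X : T → Ω → ℝ) (f : T → E) (ν : Measure T) (P : Measure Ω) :
    Prop where
  measurable : Measurable (Function.uncurry X)
  memLp : ∀ u, MemLp (X u) 2 P
  aestronglyMeasurable : AEStronglyMeasurable f ν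
  integrable : Integrable (fun u => lpNorm (X u) 2 P • f u) ν

namespace MeanSquareIntegrable

lemma clm_comp (h : MeanSquareIntegrable X f ν P) (L : E →L[ℝ] F) :
    MeanSquareIntegrable X (fun u => L (f u)) ν P where
  measurable := h.measurable
  memLp := h.memLp
  aestronglyMeasurable := L.continuous.comp_aestronglyMeasurable h.aestronglyMeasurable
  integrable := by simpa only [map_smul] using L.integrable_comp h.integrable

lemma aestronglyMeasurable_smul [SFinite P] (h : MeanSquareIntegrable X f ν P) :
    AEStronglyMeasurable (fun z : Ω × T => X z.2 z.1 • f z.2) (P.prod ν) :=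
  (h.measurable.comp measurable_swap).aestronglyMeasurable.smul h.aestronglyMeasurable.comp_snd

variable [SFinite ν] [SFinite P]

lemma eLpNorm_lintegral_enorm_lt_top (h : MeanSquareIntegrable X f ν P) :
    eLpNorm (fun ω => ∫⁻ u, ‖X u ω • f u‖ₑ ∂ν) 2 P < ∞ := by
  have h_eLpNorm (u : T) :
      eLpNorm (fun ω => ‖X u ω • f u‖ₑ) 2 P = ‖lpNorm (X u) 2 P • f u‖ₑ := by
    have h_norm : eLpNorm (fun ω => X u ω • f u) 2 P = eLpNorm (‖f u‖ • X u) 2 P :=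
      eLpNorm_congr_norm_ae (ae_of_all _ fun ω => by simp [norm_smul, mul_comm])
    rw [eLpNorm_enorm, h_norm, eLpNorm_const_smul, enorm_smul, enorm_norm, mul_comm,
      ← ofReal_lpNorm (h.memLp u), Real.enorm_of_nonneg lpNorm_nonneg]
  have h_meas : AEMeasurable (Function.uncurry fun u ω => ‖X u ω • f u‖ₑ) (ν.prod P) :=
    h.aestronglyMeasurable_smul.enorm.prod_swap
  calc eLpNorm (fun ω => ∫⁻ u, ‖X u ω • f u‖ₑ ∂ν) 2 P
      ≤ ∫⁻ u, eLpNorm (fun ω => ‖X u ω • f u‖ₑ) 2 P ∂ν := eLpNorm_two_lintegral_le h_meas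
    _ < ∞ := by
        simp_rw [h_eLpNorm]
        exact h.integrable.hasFiniteIntegral

lemma memLp_pathIntegral (h : MeanSquareIntegrable X f ν P) :
    MemLp (pathIntegral ν X f) 2 P :=
  ⟨h.aestronglyMeasurable_smul.integral_prod_right',
    (eLpNorm_mono_enorm fun _ => enorm_integral_le_lintegral_enorm _).trans_lt
      h.eLpNorm_lintegral_enorm_lt_top⟩

lemma integrable_smul_smul (h : MeanSquareIntegrable X f ν P) {Y : Ω → ℝ} (hY : MemLp Y 2 P) :
    Integrable (fun z : Ω × T => Y z.1 • X z.2 z.1 • f z.2) (P.prod ν) := by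
  have h_meas : AEStronglyMeasurable (fun z : Ω × T => Y z.1 • X z.2 z.1 • f z.2) (P.prod ν) :=
    hY.1.comp_fst.smul h.aestronglyMeasurable_smul
  refine ⟨h_meas, ?_⟩
  calc ∫⁻ z, ‖Y z.1 • X z.2 z.1 • f z.2‖ₑ ∂P.prod ν
      = ∫⁻ ω, ‖Y ω‖ₑ * ∫⁻ u, ‖X u ω • f u‖ₑ ∂ν ∂P := by
        rw [lintegral_prod _ h_meas.enorm]
        simp_rw [enorm_smul (Y _), lintegral_const_mul' _ _ enorm_ne_top]
    _ ≤ eLpNorm (fun ω => ‖Y ω‖ₑ) 2 P * eLpNorm (fun ω => ∫⁻ u, ‖X u ω • f u‖ₑ ∂ν) 2 P :=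
        lintegral_mul_le_eLpNorm_two_mul_eLpNorm_two hY.1.enorm
          h.aestronglyMeasurable_smul.enorm.lintegral_prod_right'
    _ < ∞ := by
        rw [eLpNorm_enorm]
        exact ENNReal.mul_lt_top hY.2 h.eLpNorm_lintegral_enorm_lt_top

end MeanSquareIntegrable

lemma MeanSquareIntegrable.ae_integrable [SFinite ν] [IsFiniteMeasure P]
    (h : MeanSquareIntegrable X f ν P) : ∀ᵐ ω ∂P, Integrable (fun u => X u ω • f u) ν := by
  simpa using (h.integrable_smul_smul (memLp_const 1)).prod_right_ae

lemma clm_comp_pathIntegral_ae_eq [CompleteSpace E] [CompleteSpace F] [SFinite ν]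
    [IsFiniteMeasure P] (h : MeanSquareIntegrable X f ν P) (L : E →L[ℝ] F) :
    L ∘ pathIntegral ν X f =ᵐ[P] pathIntegral ν X (fun u => L (f u)) := by
  filter_upwards [h.ae_integrable] with ω hω
  simp only [pathIntegral, Function.comp_apply, ← L.integral_comp_comm hω, map_smul]

lemma integral_smul_pathIntegral [CompleteSpace E] [SFinite ν] [SFinite P]
    (h : MeanSquareIntegrable X f ν P) {Y : Ω → ℝ} (hY : MemLp Y 2 P) :
    ∫ ω, Y ω • pathIntegral ν X f ω ∂P = ∫ u, (∫ ω, Y ω * X u ω ∂P) • f u ∂ν := by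
  simp_rw [pathIntegral, ← integral_smul]
  rw [integral_integral_swap (h.integrable_smul_smul hY)]
  simp_rw [smul_smul, integral_smul_const]

section Covariance

variable [SFinite ν] [IsProbabilityMeasure P] {f g : T → ℝ}

lemma covariance_eq_integral_sub_mul {Y Z : Ω → ℝ} (hY : MemLp Y 2 P) (hZ : MemLp Z 2 P) :
    cov[Y, Z; P] = ∫ ω, (Y ω - P[Y]) * Z ω ∂P := by
  simp_rw [covariance_eq_sub hY hZ, sub_mul, ← integral_const_mul]
  exact (integral_sub (hY.integrable_mul hZ) ((hZ.integrable one_le_two).const_mul _)).symm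

lemma covariance_pathIntegral_right (hf : MeanSquareIntegrable X f ν P) {Y : Ω → ℝ}
    (hY : MemLp Y 2 P) :
    cov[Y, pathIntegral ν X f; P] = ∫ u, cov[Y, X u; P] * f u ∂ν := by
  simp_rw [covariance_eq_integral_sub_mul hY hf.memLp_pathIntegral,
    covariance_eq_integral_sub_mul hY (hf.memLp _)]
  exact integral_smul_pathIntegral hf (hY.sub (memLp_const P[Y]))

lemma covariance_pathIntegral (hf : MeanSquareIntegrable X f ν P)
    (hg : MeanSquareIntegrable X g ν P) :
    cov[pathIntegral ν X f, pathIntegral ν X g; P] =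
      ∫ v, ∫ u, cov[X u, X v; P] * (f u * g v) ∂ν ∂ν := by
  rw [covariance_pathIntegral_right hg hf.memLp_pathIntegral]
  congr with v
  rw [covariance_comm, covariance_pathIntegral_right hf (hf.memLp v), ← integral_mul_const]
  simp_rw [covariance_comm (X v), mul_assoc]

end Covariance

end MeanSquareIntegral

section GaussianIntegral

variable {T Ω : Type*} [MeasurableSpace Ω] {P : Measure Ω}

lemma inner_toLp_eq_integral_mul (Y : Lp ℝ 2 P) {Z : Ω → ℝ} (hZ : MemLp Z 2 P) :
    inner ℝ Y (hZ.toLp Z) = ∫ ω, Y ω * Z ω ∂P := by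
  rw [L2.inner_def]
  refine integral_congr_ae ?_
  filter_upwards [hZ.coeFn_toLp] with ω hω
  simp [hω, mul_comm]

lemma toLp_pathIntegral_mem_topologicalClosure_span [MeasurableSpace T] {ν : Measure T}
    [SFinite ν] [SFinite P] {X : T → Ω → ℝ} {f : T → ℝ} (h : MeanSquareIntegrable X f ν P) :
    h.memLp_pathIntegral.toLp ∈
      (Submodule.span ℝ (range fun u => (h.memLp u).toLp)).topologicalClosure := by
  rw [← Submodule.orthogonal_orthogonal_eq_closure, Submodule.mem_orthogonal]
  intro Y hY
  have h_orthogonal (u : T) : ∫ ω, Y ω * X u ω ∂P = 0 := by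
    rw [← inner_toLp_eq_integral_mul Y (h.memLp u)]
    exact (Submodule.mem_orthogonal' _ _).1 hY _ (Submodule.subset_span (mem_range_self u))
  have h_fubini := integral_smul_pathIntegral h (Lp.memLp Y)
  simp only [h_orthogonal, zero_smul, integral_zero] at h_fubini
  rwa [inner_toLp_eq_integral_mul]

lemma hasGaussianLaw_of_mem_span {X : T → Ω → ℝ} (hX : IsGaussianProcess X P)
    (hX_memLp : ∀ u, MemLp (X u) 2 P) {Z : Lp ℝ 2 P}
    (hZ : Z ∈ Submodule.span ℝ (range fun u => (hX_memLp u).toLp)) : HasGaussianLaw Z P := by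
  obtain ⟨c, rfl⟩ := Finsupp.mem_span_range_iff_exists_finsupp.1 hZ
  refine (hX.smul c).hasGaussianLaw_sum (I := c.support) |>.congr ?_
  have h_terms : ∀ᵐ ω ∂P, ∀ u ∈ c.support,
      (c u • (hX_memLp u).toLp : Lp ℝ 2 P) ω = c u • X u ω := by
    rw [Finset.eventually_all]
    intro u _
    filter_upwards [Lp.coeFn_smul (c u) (hX_memLp u).toLp, (hX_memLp u).coeFn_toLp]
      with ω h_smul h_toLp
    rw [h_smul, Pi.smul_apply, h_toLp]
  filter_upwards [h_terms, Lp.coeFn_finsetSum c.support fun u => c u • (hX_memLp u).toLp]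
    with ω hω h_sum
  rw [Finsupp.sum, h_sum, Finset.sum_apply, Finset.sum_apply]
  exact Finset.sum_congr rfl fun u hu => (hω u hu).symm

variable [IsProbabilityMeasure P]

lemma continuous_integral_Lp_two : Continuous fun Z : Lp ℝ 2 P => ∫ ω, Z ω ∂P := by
  have h_inner (Z : Lp ℝ 2 P) : ∫ ω, Z ω ∂P = inner ℝ Z (memLp_const (1 : ℝ)).toLp := by
    simp only [inner_toLp_eq_integral_mul, mul_one]
  simp_rw [h_inner]
  fun_prop

lemma continuous_variance_Lp_two : Continuous fun Z : Lp ℝ 2 P => Var[Z; P] := by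
  have h_variance (Z : Lp ℝ 2 P) : Var[Z; P] = ‖Z‖ ^ 2 - (∫ ω, Z ω ∂P) ^ 2 := by
    rw [variance_eq_sub (Lp.memLp Z), ← real_inner_self_eq_norm_sq, L2.inner_def]
    simp [pow_two]
  simp_rw [h_variance]
  exact (continuous_norm.pow 2).sub (continuous_integral_Lp_two.pow 2)

lemma continuous_charFun_map_Lp_two (t : ℝ) :
    Continuous fun Z : Lp ℝ 2 P => charFun (P.map Z) t := by
  refine continuous_iff_seqContinuous.2 fun Z Z₀ hZ => ?_
  have h_law := (tendstoInMeasure_of_tendsto_Lp hZ).tendstoInDistribution fun n =>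
    (Lp.aestronglyMeasurable (Z n)).aemeasurable
  exact ProbabilityMeasure.tendsto_iff_tendsto_charFun.1 h_law.tendsto t

theorem isClosed_setOf_hasGaussianLaw : IsClosed {Z : Lp ℝ 2 P | HasGaussianLaw Z P} := by
  have h_charFun (Z : Lp ℝ 2 P) : HasGaussianLaw Z P ↔ ∀ t : ℝ, charFun (P.map Z) t =
      Complex.exp ((t * ∫ ω, Z ω ∂P : ℝ) * Complex.I - (t ^ 2 * Var[Z; P] : ℝ) / 2) := by
    rw [hasGaussianLaw_iff_charFun_map_eq (Lp.aestronglyMeasurable Z).aemeasurable]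
    simp [← integral_const_mul, ← variance_const_mul, mul_comm]
  simp_rw [h_charFun, ofPred_forall]
  refine isClosed_iInter fun t => isClosed_eq (continuous_charFun_map_Lp_two t) ?_
  have h_mean := continuous_integral_Lp_two (P := P)
  have h_variance := continuous_variance_Lp_two (P := P)
  fun_prop

variable [MeasurableSpace T] {ν : Measure T} [SFinite ν] {X : T → Ω → ℝ}

lemma hasGaussianLaw_pathIntegral_real (hX : IsGaussianProcess X P) {f : T → ℝ}
    (h : MeanSquareIntegrable X f ν P) : HasGaussianLaw (pathIntegral ν X f) P := by
  have h_law : HasGaussianLaw h.memLp_pathIntegral.toLp P :=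
    closure_minimal (fun Z hZ => hasGaussianLaw_of_mem_span hX h.memLp hZ)
      isClosed_setOf_hasGaussianLaw (toLp_pathIntegral_mem_topologicalClosure_span h)
  exact h_law.congr h.memLp_pathIntegral.coeFn_toLp

theorem hasGaussianLaw_pathIntegral {E : Type*} [NormedAddCommGroup E] [NormedSpace ℝ E]
    [CompleteSpace E] [MeasurableSpace E] [BorelSpace E] (hX : IsGaussianProcess X P)
    {f : T → E} (h : MeanSquareIntegrable X f ν P) : HasGaussianLaw (pathIntegral ν X f) P := by
  refine ⟨isGaussian_of_isGaussian_map fun L => ?_⟩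
  rw [AEMeasurable.map_map_of_aemeasurable (by fun_prop)
    h.memLp_pathIntegral.aestronglyMeasurable.aemeasurable]
  exact (hasGaussianLaw_pathIntegral_real hX (h.clm_comp L)).congr
    (clm_comp_pathIntegral_ae_eq h L).symm |>.isGaussian_map

end GaussianIntegral

section HomogeneousIncrements

variable {G Ω : Type*} [MeasurableSpace Ω] {P : Measure Ω} {Y : G → Ω → ℝ}

/-- The increments of `Y` are distributed like `Y` itself: `Y u - Y v ∼ Y (u - v)`. This is
stationarity of the increments, at the level of single increments, for a process that starts at
zero. -/
def HasHomogeneousIncrements [AddGroup G] (Y : G → Ω → ℝ) (P : Measure Ω) : Prop :=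
  ∀ u v, IdentDistrib (Y u - Y v) (Y (u - v)) P P

/-- The process `Y` with the mean subtracted. -/
noncomputable def centered (P : Measure Ω) (Y : G → Ω → ℝ) (u : G) (ω : Ω) : ℝ :=
  Y u ω - P[Y u]

lemma memLp_centered [IsFiniteMeasure P] {p : ℝ≥0∞} {u : G} (h : MemLp (Y u) p P) :
    MemLp (centered P Y u) p P :=
  h.sub (memLp_const _)

lemma variance_eq_lpNorm_centered_sq {u : G} (hY : AEStronglyMeasurable (Y u) P) :
    Var[Y u; P] = lpNorm (centered P Y u) 2 P ^ 2 := by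
  have h_sq_nonneg : 0 ≤ ∫ ω, centered P Y u ω ^ 2 ∂P := integral_nonneg fun ω => sq_nonneg _
  have hY_centered : AEStronglyMeasurable (centered P Y u) P := hY.sub aestronglyMeasurable_const
  rw [variance_eq_integral hY.aemeasurable,
    lpNorm_eq_integral_norm_rpow_toReal two_ne_zero ENNReal.ofNat_ne_top hY_centered]
  simp only [ENNReal.toReal_ofNat, Real.rpow_ofNat, Real.norm_eq_abs, sq_abs]
  rw [← Real.rpow_natCast, ← Real.rpow_mul h_sq_nonneg]
  simp [centered]

lemma measurable_uncurry_centered [MeasurableSpace G] [SFinite P]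
    (hY : Measurable (Function.uncurry Y)) : Measurable (Function.uncurry (centered P Y)) :=
  hY.sub (hY.stronglyMeasurable.integral_prod_right.measurable.comp measurable_fst)

lemma measurable_lpNorm_two [MeasurableSpace G] [SFinite P]
    (hY : Measurable (Function.uncurry Y)) : Measurable fun u => lpNorm (Y u) 2 P := by
  have hY_section (u : G) : AEStronglyMeasurable (Y u) P :=
    (hY.comp measurable_prodMk_left).aestronglyMeasurable
  simp_rw [fun u => lpNorm_eq_integral_norm_rpow_toReal two_ne_zero ENNReal.ofNat_ne_top
    (hY_section u)]
  exact (hY.norm.pow_const _).stronglyMeasurable.integral_prod_right.measurable.pow_const _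

namespace HasHomogeneousIncrements

variable [AddGroup G]

lemma lpNorm_sub (hY : HasHomogeneousIncrements Y P) (p : ℝ≥0∞) (u v : G) :
    lpNorm (Y u - Y v) p P = lpNorm (Y (u - v)) p P := by
  rw [← toReal_eLpNorm (hY u v).aemeasurable_fst.aestronglyMeasurable,
    ← toReal_eLpNorm (hY u v).aemeasurable_snd.aestronglyMeasurable, (hY u v).eLpNorm_eq]

/-- The `Lᵖ` norm of a process with homogeneous increments, as a function of the index. -/
noncomputable def lpSeminorm (hY : HasHomogeneousIncrements Y P) {p : ℝ≥0∞} (hp : 1 ≤ p)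
    (hY_memLp : ∀ u, MemLp (Y u) p P) : AddGroupSeminorm G :=
  have h_zero : lpNorm (Y 0) p P = 0 := by
    rw [← sub_self 0, ← hY.lpNorm_sub, sub_self, lpNorm_zero]
  have h_neg (u : G) : lpNorm (Y (-u)) p P = lpNorm (Y u) p P := by
    rw [← zero_sub, ← hY.lpNorm_sub, lpNorm_sub_comm, hY.lpNorm_sub, sub_zero]
  { toFun := fun u => lpNorm (Y u) p P
    map_zero' := h_zero
    add_le' := fun u v => by
      rw [← sub_neg_eq_add, ← hY.lpNorm_sub, ← h_neg v]
      exact lpNorm_sub_le (hY_memLp u) hp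
    neg' := h_neg }

lemma centered [IsFiniteMeasure P] (hY : HasHomogeneousIncrements Y P)
    (hY_int : ∀ u, Integrable (Y u) P) : HasHomogeneousIncrements (centered P Y) P := by
  intro u v
  have h_mean : P[Y (u - v)] = P[Y u] - P[Y v] := by
    rw [← (hY u v).integral_eq, integral_sub' (hY_int u) (hY_int v)]
  have h_sub : WaveletCov.centered P Y u - WaveletCov.centered P Y v =
      fun ω => (Y u - Y v) ω - P[Y (u - v)] := by
    ext ω
    simp only [WaveletCov.centered, Pi.sub_apply, h_mean]
    ring
  rw [h_sub]
  exact (hY u v).sub_const _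

variable [IsProbabilityMeasure P]

/-- The standard deviation of a process with homogeneous increments, as a function of the index. -/
noncomputable def stdSeminorm (hY : HasHomogeneousIncrements Y P)
    (hY_memLp : ∀ u, MemLp (Y u) 2 P) : AddGroupSeminorm G :=
  (hY.centered fun u => (hY_memLp u).integrable one_le_two).lpSeminorm one_le_two
    fun u => memLp_centered (hY_memLp u)

lemma measurable_stdSeminorm [MeasurableSpace G] (hY : HasHomogeneousIncrements Y P)
    (hY_meas : Measurable (Function.uncurry Y)) (hY_memLp : ∀ u, MemLp (Y u) 2 P) :
    Measurable (hY.stdSeminorm hY_memLp) :=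
  measurable_lpNorm_two (measurable_uncurry_centered hY_meas)

lemma covariance_eq_incrementKernel (hY : HasHomogeneousIncrements Y P)
    (hY_memLp : ∀ u, MemLp (Y u) 2 P) (u v : G) :
    cov[Y u, Y v; P] = incrementKernel (hY.stdSeminorm hY_memLp) u v := by
  have h_variance (w : G) : Var[Y w; P] = hY.stdSeminorm hY_memLp w ^ 2 :=
    variance_eq_lpNorm_centered_sq (hY_memLp w).1
  have h_polarization := variance_sub (hY_memLp u) (hY_memLp v)
  rw [(hY u v).variance_eq, h_variance, h_variance, h_variance] at h_polarization
  rw [incrementKernel]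
  linarith

end HasHomogeneousIncrements

end HomogeneousIncrements

section FirstMoment

variable {V E F : Type*} [NormedAddCommGroup V] [MeasureSpace V]
  [NormedAddCommGroup E] [NormedSpace ℝ E] [NormedAddCommGroup F] [NormedSpace ℝ F]

/-- `f` is integrable and has a finite first moment. This is the decay condition on wavelets. -/
def HasFirstMoment (f : V → E) : Prop :=
  Integrable fun u => (1 + ‖u‖) • f u

namespace HasFirstMoment

variable {f : V → E}

lemma clm_comp (hf : HasFirstMoment f) (L : E →L[ℝ] F) : HasFirstMoment fun u => L (f u) := by
  simpa only [HasFirstMoment, map_smul] using L.integrable_comp hf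

variable [OpensMeasurableSpace V]

lemma integrable_smul (hf : HasFirstMoment f) {w : V → ℝ} (hw : Measurable w) {C : ℝ}
    (hC : ∀ u, |w u| ≤ C * (1 + ‖u‖)) : Integrable fun u => w u • f u := by
  have h_ratio : (fun u => w u • f u) = fun u => (w u / (1 + ‖u‖)) • (1 + ‖u‖) • f u := by
    ext u
    rw [smul_smul, div_mul_cancel₀ _ (by positivity)]
  rw [h_ratio]
  refine Integrable.bdd_smul hf C (Measurable.aestronglyMeasurable (by fun_prop))
    (ae_of_all _ fun u => ?_)
  rw [norm_div, Real.norm_of_nonneg (by positivity : 0 ≤ 1 + ‖u‖), div_le_iff₀ (by positivity)]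
  exact hC u

lemma integrable (hf : HasFirstMoment f) : Integrable f := by
  simpa using hf.integrable_smul (w := 1) measurable_one (C := 1) (by simp)

end HasFirstMoment

end FirstMoment

section Uncorrelated

variable {V E Ω : Type*} [NormedAddCommGroup V] [InnerProductSpace ℝ V] [FiniteDimensional ℝ V]
  [MeasurableSpace V] [BorelSpace V] [NormedAddCommGroup E] [NormedSpace ℝ E]
  [MeasurableSpace Ω] {P : Measure Ω} {Y : V → Ω → ℝ}

lemma HasHomogeneousIncrements.meanSquareIntegrable [SFinite P] {f : V → E}
    (hY : HasHomogeneousIncrements Y P) (hY_meas : Measurable (Function.uncurry Y))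
    (hY_memLp : ∀ u, MemLp (Y u) 2 P) (hf : HasFirstMoment f) :
    MeanSquareIntegrable Y f volume P where
  measurable := hY_meas
  memLp := hY_memLp
  aestronglyMeasurable := hf.integrable.1
  integrable := by
    have h_meas := measurable_lpNorm_two (P := P) hY_meas
    obtain ⟨C, hC⟩ := exists_le_mul_one_add_norm (hY.lpSeminorm one_le_two hY_memLp) h_meas
    exact hf.integrable_smul h_meas fun u => (abs_of_nonneg lpNorm_nonneg).trans_le (hC u)

variable [IsProbabilityMeasure P]

theorem covariance_pathIntegral_eq_zero {f g : V → ℝ} (hY : HasHomogeneousIncrements Y P)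
    (hY_meas : Measurable (Function.uncurry Y)) (hY_memLp : ∀ u, MemLp (Y u) 2 P)
    (hf : HasFirstMoment f) (hg : HasFirstMoment g) (hf_mean : ∫ u, f u = 0)
    (hg_mean : ∫ v, g v = 0)
    (h : ∀ ξ, 𝓕 (fun u => (f u : ℂ)) ξ * 𝓕 (fun v => (g v : ℂ)) (-ξ) = 0) :
    cov[pathIntegral volume Y f, pathIntegral volume Y g; P] = 0 := by
  obtain ⟨σ, hσ, h_cov⟩ : ∃ σ : AddGroupSeminorm V, Measurable σ ∧
      ∀ u v, cov[Y u, Y v; P] = incrementKernel σ u v :=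
    ⟨hY.stdSeminorm hY_memLp, hY.measurable_stdSeminorm hY_meas hY_memLp,
      hY.covariance_eq_incrementKernel hY_memLp⟩
  obtain ⟨C, hC⟩ := exists_le_mul_one_add_norm σ hσ
  have h_weighted {q : V → ℝ} (hq : HasFirstMoment q) :
      Integrable fun u => (σ u : ℂ) * (q u : ℂ) := by
    simpa using (hq.integrable_smul hσ
      fun u => (abs_of_nonneg (apply_nonneg σ u)).trans_le (hC u)).ofReal (𝕜 := ℂ)
  have hf_int : Integrable fun u => (f u : ℂ) := hf.integrable.ofReal
  have hg_int : Integrable fun v => (g v : ℂ) := hg.integrable.ofReal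
  rw [covariance_pathIntegral (hY.meanSquareIntegrable hY_meas hY_memLp hf)
    (hY.meanSquareIntegrable hY_meas hY_memLp hg), ← Complex.ofReal_eq_zero]
  simp_rw [h_cov, ← integral_complex_ofReal]
  push_cast
  have h_fubini := integral_prod_symm _
    (integrable_incrementKernel_mul hσ hf_int.1 hg_int.1 (h_weighted hf) (h_weighted hg))
  refine h_fubini.symm.trans ?_
  exact integral_incrementKernel_mul_eq_zero hσ hf_int hg_int (h_weighted hf) (h_weighted hg)
    (by rw [integral_complex_ofReal, hf_mean, Complex.ofReal_zero])
    (by rw [integral_complex_ofReal, hg_mean, Complex.ofReal_zero]) h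

end Uncorrelated

section Independence

variable {V : Type*} [NormedAddCommGroup V] [InnerProductSpace ℝ V] [MeasurableSpace V]
  [BorelSpace V] [FiniteDimensional ℝ V] {f g : V → ℂ}

lemma fourier_conj (f : V → ℂ) (ξ : V) : 𝓕 (fun u => conj (f u)) ξ = conj (𝓕 f (-ξ)) := by
  rw [Real.fourier_eq', Real.fourier_eq', ← integral_conj]
  congr with u
  simp [← Complex.exp_conj, Complex.conj_ofNat]

lemma ofReal_clm_apply (L : ℂ →L[ℝ] ℝ) (z : ℂ) :
    ((L z : ℝ) : ℂ) = (L 1 - Complex.I * L Complex.I) / 2 * z +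
      (L 1 + Complex.I * L Complex.I) / 2 * conj z := by
  have h_apply : L z = z.re * L 1 + z.im * L Complex.I := by
    conv_lhs => rw [← Complex.re_add_im z, ← mul_one (z.re : ℂ), ← Complex.real_smul,
      ← Complex.real_smul, map_add, map_smul, map_smul, smul_eq_mul, smul_eq_mul]
  rw [h_apply]
  apply Complex.ext <;> simp <;> ring

lemma fourier_ofReal_clm (L : ℂ →L[ℝ] ℝ) (hf : Integrable f) (ξ : V) :
    𝓕 (fun u => ((L (f u) : ℝ) : ℂ)) ξ = (L 1 - Complex.I * L Complex.I) / 2 * 𝓕 f ξ +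
      (L 1 + Complex.I * L Complex.I) / 2 * conj (𝓕 f (-ξ)) := by
  have hf_conj : Integrable fun u => conj (f u) :=
    (Complex.conjCLE : ℂ →L[ℝ] ℂ).integrable_comp hf
  rw [← fourier_conj]
  simp_rw [Real.fourier_eq, fun u => ofReal_clm_apply L (f u), smul_add, ← mul_smul_comm]
  rw [integral_add (((Real.fourierIntegral_convergent_iff ξ).2 hf).const_mul _)
    (((Real.fourierIntegral_convergent_iff ξ).2 hf_conj).const_mul _), integral_const_mul,
    integral_const_mul]

lemma fourier_ofReal_clm_mul_eq_zero (L M : ℂ →L[ℝ] ℝ) (hf : Integrable f) (hg : Integrable g)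
    (h : ∀ ξ, 𝓕 f ξ * 𝓕 g ξ = 0) (h_neg : ∀ ξ, 𝓕 f ξ * 𝓕 g (-ξ) = 0) (ξ : V) :
    𝓕 (fun u => ((L (f u) : ℝ) : ℂ)) ξ * 𝓕 (fun v => ((M (g v) : ℝ) : ℂ)) (-ξ) = 0 := by
  rw [fourier_ofReal_clm L hf, fourier_ofReal_clm M hg, neg_neg]
  have h_fg : 𝓕 f ξ * 𝓕 g (-ξ) = 0 := h_neg ξ
  have h_f_conj_g : 𝓕 f ξ * conj (𝓕 g ξ) = 0 := by simpa using h ξ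
  have h_conj_f_g : conj (𝓕 f (-ξ)) * 𝓕 g (-ξ) = 0 := by simpa using h (-ξ)
  have h_conj_f_conj_g : conj (𝓕 f (-ξ)) * conj (𝓕 g ξ) = 0 := by simpa using h_neg (-ξ)
  generalize (L 1 - Complex.I * L Complex.I : ℂ) / 2 = a,
    (L 1 + Complex.I * L Complex.I : ℂ) / 2 = a',
    (M 1 - Complex.I * M Complex.I : ℂ) / 2 = b,
    (M 1 + Complex.I * M Complex.I : ℂ) / 2 = b'
  linear_combination a * b * h_fg + a * b' * h_f_conj_g + a' * b * h_conj_f_g +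
    a' * b' * h_conj_f_conj_g

variable {Ω : Type*} [MeasurableSpace Ω] {P : Measure Ω}

lemma covariance_congr_ae {A A' B B' : Ω → ℝ} (hA : A =ᵐ[P] A') (hB : B =ᵐ[P] B') :
    cov[A, B; P] = cov[A', B'; P] := by
  simp only [covariance, integral_congr_ae hA, integral_congr_ae hB]
  refine integral_congr_ae ?_
  filter_upwards [hA, hB] with ω hAω hBω
  rw [hAω, hBω]

/-- Disjointness of the spectra of `f` and `g`, and of those of `f` and `conj g`, makes all real and
imaginary parts of the two integrals uncorrelated, and these are jointly Gaussian. -/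
theorem indepFun_pathIntegral [IsProbabilityMeasure P] {Y : V → Ω → ℝ}
    (hY : HasHomogeneousIncrements Y P) (hY_meas : Measurable (Function.uncurry Y))
    (hG : IsGaussianProcess Y P) (hf : HasFirstMoment f) (hg : HasFirstMoment g)
    (hf_mean : ∫ u, f u = 0) (hg_mean : ∫ v, g v = 0) (h : ∀ ξ, 𝓕 f ξ * 𝓕 g ξ = 0)
    (h_neg : ∀ ξ, 𝓕 f ξ * 𝓕 g (-ξ) = 0) :
    IndepFun (pathIntegral volume Y f) (pathIntegral volume Y g) P := by
  have hY_memLp (u : V) : MemLp (Y u) 2 P := (hG.hasGaussianLaw_eval u).memLp_two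
  have hYf := hY.meanSquareIntegrable hY_meas hY_memLp hf
  have hYg := hY.meanSquareIntegrable hY_meas hY_memLp hg
  have hfg : HasFirstMoment fun u => (f u, g u) := Integrable.prodMk hf hg
  have h_pair : pathIntegral volume Y (fun u => (f u, g u)) =ᵐ[P]
      fun ω => (pathIntegral volume Y f ω, pathIntegral volume Y g ω) := by
    filter_upwards [hYf.ae_integrable, hYg.ae_integrable] with ω hωf hωg
    exact integral_pair hωf hωg
  have h_gaussian := (hasGaussianLaw_pathIntegral hG
    (hY.meanSquareIntegrable hY_meas hY_memLp hfg)).congr h_pair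
  refine h_gaussian.indepFun_of_covariance_strongDual fun L M => ?_
  rw [covariance_congr_ae (clm_comp_pathIntegral_ae_eq hYf L) (clm_comp_pathIntegral_ae_eq hYg M)]
  exact covariance_pathIntegral_eq_zero hY hY_meas hY_memLp (hf.clm_comp L) (hg.clm_comp M)
    (by rw [L.integral_comp_comm hf.integrable, hf_mean, map_zero])
    (by rw [M.integral_comp_comm hg.integrable, hg_mean, map_zero])
    (fourier_ofReal_clm_mul_eq_zero L M hf.integrable hg.integrable h h_neg)

end Independence

section StationaryIncrements

variable {Ω : Type*}

/-- The process `X - X 0`. Its marginals, unlike those of `X`, are determined by the laws of the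
increments of `X`, and it has the same integrals against weights with zero average. -/
def started {G : Type*} [Zero G] (X : G → Ω → ℝ) (u : G) (ω : Ω) : ℝ :=
  X u ω - X 0 ω

lemma started_sub_started {G : Type*} [Zero G] (X : G → Ω → ℝ) (u v : G) :
    started X u - started X v = X u - X v := by
  ext ω
  simp [started]

lemma increment_logb (X : ℝ → Ω → ℝ) {u v : ℝ} (h : v < u) :
    increment X (Real.logb 2 (u - v)) u = X u - X v := by
  ext ω
  have h_step : (2 : ℝ) ^ Real.logb 2 (u - v) = u - v :=
    Real.rpow_logb two_pos (by norm_num) (sub_pos.2 h)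
  simp [increment, h_step]

variable [MeasurableSpace Ω] {P : Measure Ω} {X : ℝ → Ω → ℝ}

lemma measurable_uncurry_started {G : Type*} [Zero G] [MeasurableSpace G] {X : G → Ω → ℝ}
    (hX : Measurable (Function.uncurry X)) : Measurable (Function.uncurry (started X)) :=
  hX.sub (hX.comp (measurable_const.prodMk measurable_snd))

lemma isGaussianProcess_started (hX : IsGaussianProcess X P) :
    IsGaussianProcess (started X) P := by
  have h_shift := hX.shift 0
  simp only [zero_add] at h_shift
  exact h_shift

lemma IsStationary.identDistrib (hX : IsStationary X P) (hX_meas : ∀ t, Measurable (X t))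
    (s t : ℝ) : IdentDistrib (X s) (X t) P P where
  aemeasurable_fst := (hX_meas s).aemeasurable
  aemeasurable_snd := (hX_meas t).aemeasurable
  map_eq := by
    let eval (x : ({t} : Finset ℝ) → ℝ) : ℝ := x ⟨t, Finset.mem_singleton_self t⟩
    have h_eval : Measurable eval := measurable_pi_apply _
    have h_restrict (Y : ℝ → Ω → ℝ) (hY : ∀ r, Measurable (Y r)) :
        Measurable fun ω => ({t} : Finset ℝ).restrict fun r => Y r ω :=
      measurable_pi_lambda _ fun r => hY r
    have h_map := congrArg (Measure.map eval) (hX (s - t) {t})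
    rw [Measure.map_map h_eval (h_restrict (fun r => X (r + (s - t))) fun r => hX_meas _),
      Measure.map_map h_eval (h_restrict X hX_meas)] at h_map
    simpa [Function.comp_def, eval] using h_map

lemma HasStationaryIncrements.hasHomogeneousIncrements_started
    (hX : HasStationaryIncrements X P) (hX_meas : ∀ t, Measurable (X t)) :
    HasHomogeneousIncrements (started X) P := by
  have h_of_lt {u v : ℝ} (h : v < u) : IdentDistrib (X u - X v) (X (u - v) - X 0) P P := by
    have h_law := (hX (Real.logb 2 (u - v))).identDistrib
      (fun t => (hX_meas t).sub (hX_meas _)) u (u - v)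
    have h_from_zero := increment_logb X (sub_pos.2 h)
    rw [sub_zero] at h_from_zero
    rwa [increment_logb X h, h_from_zero] at h_law
  have h_of_gt {u v : ℝ} (h : u < v) : IdentDistrib (X u - X v) (X 0 - X (v - u)) P P := by
    simpa [Function.comp_def, Pi.sub_def] using (h_of_lt h).comp measurable_neg
  intro u v
  rw [started_sub_started]
  rcases lt_trichotomy v u with h | rfl | h
  · exact h_of_lt h
  · rw [sub_self, sub_self]
    exact .of_ae_eq aemeasurable_const (ae_of_all _ fun ω => (sub_self (X 0 ω)).symm)
  · have h_reversed := h_of_gt (sub_neg.2 h)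
    rw [zero_sub, neg_sub] at h_reversed
    exact (h_of_gt h).trans h_reversed.symm

end StationaryIncrements

section SubConst

variable {T E : Type*} [MeasurableSpace T] {ν : Measure T} [NormedAddCommGroup E]
  [NormedSpace ℝ E] {f : T → E}

lemma integrable_sub_const_smul_iff (hf : Integrable f ν) (x : T → ℝ) (c : ℝ) :
    Integrable (fun u => (x u - c) • f u) ν ↔ Integrable (fun u => x u • f u) ν := by
  simp_rw [sub_smul, sub_eq_add_neg]
  exact integrable_add_iff_integrable_left (hf.smul c).neg

lemma integral_sub_const_smul (hf : Integrable f ν) (hf_mean : ∫ u, f u ∂ν = 0) (x : T → ℝ)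
    (c : ℝ) : ∫ u, (x u - c) • f u ∂ν = ∫ u, x u • f u ∂ν := by
  by_cases h : Integrable (fun u => x u • f u) ν
  · simp_rw [sub_smul]
    rw [integral_sub h (hf.fun_smul c), integral_smul, hf_mean, smul_zero, sub_zero]
  · rw [integral_undef h, integral_undef (mt (integrable_sub_const_smul_iff hf x c).1 h)]

end SubConst

section Wavelet

namespace HasFirstMoment

variable {V E : Type*} [NormedAddCommGroup V] [MeasureSpace V] [BorelSpace V]
  [NormedAddCommGroup E] [NormedSpace ℝ E] {f : V → E}

lemma comp_sub_left [(volume : Measure V).IsAddLeftInvariant]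
    [(volume : Measure V).IsNegInvariant] (hf : HasFirstMoment f) (t : V) :
    HasFirstMoment fun u => f (t - u) := by
  have h_weight (u : V) : |1 + ‖t - u‖| ≤ (1 + ‖t‖) * (1 + ‖u‖) := by
    rw [abs_of_nonneg (by positivity)]
    nlinarith [norm_sub_le t u, norm_nonneg t, norm_nonneg u]
  simpa [HasFirstMoment] using (hf.integrable_smul (by fun_prop) h_weight).comp_sub_left t

lemma comp_smul [NormedSpace ℝ V] [FiniteDimensional ℝ V]
    [(volume : Measure V).IsAddHaarMeasure] (hf : HasFirstMoment f) {c : ℝ} (hc : c ≠ 0) :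
    HasFirstMoment fun u => f (c • u) := by
  have h_weight (u : V) : |1 + ‖c⁻¹ • u‖| ≤ (1 + ‖c⁻¹‖) * (1 + ‖u‖) := by
    rw [abs_of_nonneg (by positivity), norm_smul]
    nlinarith [norm_nonneg c⁻¹, norm_nonneg u]
  simpa [HasFirstMoment, inv_smul_smul₀ hc] using
    (hf.integrable_smul (by fun_prop) h_weight).comp_smul hc

end HasFirstMoment

variable {ψ : ℝ → ℂ}

/-- The time-reversed, dilated and translated wavelet `u ↦ ψ_k(t - u)`, against which a signal is
integrated to give its wavelet coefficient at time `t` and scale `k`. -/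
noncomputable def atom (ψ : ℝ → ℂ) (t : ℝ) (k : ℤ) (u : ℝ) : ℂ :=
  dilate ψ k (t - u)

lemma IsWavelet.hasFirstMoment_atom (hψ : IsWavelet ψ) (t : ℝ) (k : ℤ) :
    HasFirstMoment (atom ψ t k) := by
  have h_moment : HasFirstMoment ψ := by simpa [HasFirstMoment] using hψ.decay
  have h_scale : (2 : ℝ) ^ (-k) ≠ 0 := by positivity
  exact ((h_moment.comp_smul h_scale).clm_comp
    (ContinuousLinearMap.mul ℝ ℂ ((2 : ℝ) ^ (-k) : ℝ))).comp_sub_left t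

lemma integral_dilate (ψ : ℝ → ℂ) (k : ℤ) : ∫ t, dilate ψ k t = ∫ t, ψ t := by
  have h_scale : (0 : ℝ) < (2 : ℝ) ^ (-k) := by positivity
  simp only [dilate]
  rw [integral_const_mul, Measure.integral_comp_mul_left, abs_of_pos (inv_pos.2 h_scale),
    ← Complex.real_smul, smul_inv_smul₀ h_scale.ne']

lemma IsWavelet.integral_atom (hψ : IsWavelet ψ) (t : ℝ) (k : ℤ) : ∫ u, atom ψ t k u = 0 := by
  simp only [atom]
  rw [integral_sub_left_eq_self (dilate ψ k) volume t, integral_dilate, hψ.zero_average]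

lemma fourier_eq_hat (f : ℝ → ℂ) (ξ : ℝ) : 𝓕 f ξ = hat f (2 * Real.pi * ξ) := by
  rw [Real.fourier_eq', hat]
  congr with t
  simp only [smul_eq_mul, RCLike.inner_apply, conj_trivial]
  rw [mul_comm]
  congr 2
  push_cast
  ring

lemma hat_zero (f : ℝ → ℂ) : hat f 0 = ∫ t, f t := by
  simp [hat]

lemma hat_dilate (ψ : ℝ → ℂ) (k : ℤ) (ω : ℝ) :
    hat (dilate ψ k) ω = hat ψ ((2 : ℝ) ^ k * ω) := by
  have h_phase (t : ℝ) : (2 : ℝ) ^ k * ω * ((2 : ℝ) ^ (-k) * t) = ω * t := by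
    rw [zpow_neg]
    field_simp
  rw [hat, hat, ← integral_dilate (fun t => ψ t * _) k]
  congr with t
  rw [dilate, dilate, mul_assoc (-Complex.I), mul_assoc (-Complex.I), ← Complex.ofReal_mul,
    ← Complex.ofReal_mul, h_phase, mul_assoc]

lemma hat_atom (ψ : ℝ → ℂ) (t : ℝ) (k : ℤ) (ω : ℝ) :
    hat (atom ψ t k) ω = Complex.exp (-Complex.I * ω * t) * hat (dilate ψ k) (-ω) := by
  simp only [hat]
  rw [← integral_const_mul, ← integral_sub_left_eq_self _ volume t]
  congr with u
  simp only [atom, sub_sub_cancel]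
  rw [mul_left_comm, ← Complex.exp_add]
  congr 2
  push_cast
  ring

lemma fourier_atom_mul_fourier_atom {j k : ℤ}
    (h_disjoint : ∀ ω : ℝ, hat (dilate ψ j) ω * hat (dilate ψ k) ω = 0) (s t ξ : ℝ) :
    𝓕 (atom ψ t j) ξ * 𝓕 (atom ψ s k) ξ = 0 := by
  rw [fourier_eq_hat, fourier_eq_hat, hat_atom, hat_atom, mul_mul_mul_comm, h_disjoint, mul_zero]

lemma hat_dilate_of_nonpos (hψ : IsWavelet ψ) (hψ_pos : PositiveFrequencies ψ) (k : ℤ) {ω : ℝ}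
    (hω : ω ≤ 0) : hat (dilate ψ k) ω = 0 := by
  rw [hat_dilate]
  rcases hω.lt_or_eq with h_neg | rfl
  · exact hψ_pos _ (mul_neg_of_pos_of_neg (by positivity) h_neg)
  · rw [mul_zero, hat_zero, hψ.zero_average]

lemma fourier_atom_mul_fourier_atom_neg (hψ : IsWavelet ψ) (hψ_pos : PositiveFrequencies ψ)
    (j k : ℤ) (s t ξ : ℝ) : 𝓕 (atom ψ t j) ξ * 𝓕 (atom ψ s k) (-ξ) = 0 := by
  rw [fourier_eq_hat, fourier_eq_hat, mul_neg, hat_atom, hat_atom, neg_neg, mul_mul_mul_comm]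
  rcases le_total (2 * Real.pi * ξ) 0 with h | h
  · rw [hat_dilate_of_nonpos hψ hψ_pos k h, mul_zero, mul_zero]
  · rw [hat_dilate_of_nonpos hψ hψ_pos j (neg_nonpos.2 h), zero_mul, mul_zero]

lemma IsWavelet.waveletTransform_eq_pathIntegral {Ω : Type*} [MeasurableSpace Ω]
    (hψ : IsWavelet ψ) (X : ℝ → Ω → ℝ) (t : ℝ) (k : ℤ) :
    (fun ω => waveletTransform ψ (fun u => X u ω) t k) =
      pathIntegral volume (started X) (atom ψ t k) :=
  funext fun ω => (integral_sub_const_smul (hψ.hasFirstMoment_atom t k).integrable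
    (hψ.integral_atom t k) (fun u => X u ω) (X 0 ω)).symm

end Wavelet

section Gaussian

variable {Ω : Type*} [MeasurableSpace Ω] {P : Measure Ω} {X : ℝ → Ω → ℝ} {ψ : ℝ → ℂ}

lemma measurable_rho : Measurable rho := by
  refine measurable_pi_iff.2 fun p => ?_
  fin_cases p
  · exact measurable_id
  · exact Complex.measurable_ofReal.comp measurable_norm

lemma covMatrix_eq_zero_of_indepFun {A B : Ω → Fin 2 → ℂ} (h : IndepFun A B P)
    (hA : AEMeasurable A P) (hB : AEMeasurable B P) : covMatrix P A B = 0 := by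
  ext p q
  have h_mul := h.integral_fun_comp_mul_comp (f := fun a => a p) (g := fun b => conj (b q)) hA hB
    (Measurable.aestronglyMeasurable (by fun_prop))
    (Continuous.aestronglyMeasurable (by fun_prop))
  rw [covMatrix, Matrix.of_apply, h_mul, integral_conj, sub_self, Matrix.zero_apply]

lemma memLp_rhoW {t : ℝ} {k : ℤ}
    (h : MemLp (fun ω => waveletTransform ψ (fun u => X u ω) t k) 2 P) (p : Fin 2) :
    MemLp (fun ω => rhoW ψ X t k ω p) 2 P := by
  fin_cases p
  · exact h
  · exact h.norm.ofReal (K := ℂ)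

variable [IsProbabilityMeasure P]

lemma meanSquareIntegrable_atom (hX : Measurable (Function.uncurry X))
    (hX_stat : HasStationaryIncrements X P) (hX_gauss : IsGaussianProcess X P)
    (hψ : IsWavelet ψ) (t : ℝ) (k : ℤ) :
    MeanSquareIntegrable (started X) (atom ψ t k) volume P :=
  HasHomogeneousIncrements.meanSquareIntegrable
    (hX_stat.hasHomogeneousIncrements_started fun _ => hX.comp measurable_prodMk_left)
    (measurable_uncurry_started hX)
    (fun u => ((isGaussianProcess_started hX_gauss).hasGaussianLaw_eval u).memLp_two)
    (hψ.hasFirstMoment_atom t k)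

theorem ae_integrable_waveletTransform (hX : Measurable (Function.uncurry X))
    (hX_stat : HasStationaryIncrements X P) (hX_gauss : IsGaussianProcess X P)
    (hψ : IsWavelet ψ) (t : ℝ) (k : ℤ) :
    ∀ᵐ ω ∂P, Integrable fun u : ℝ => (X u ω : ℂ) * dilate ψ k (t - u) := by
  filter_upwards [(meanSquareIntegrable_atom hX hX_stat hX_gauss hψ t k).ae_integrable] with ω hω
  exact (integrable_sub_const_smul_iff (hψ.hasFirstMoment_atom t k).integrable _ _).1 hω

theorem memLp_waveletTransform (hX : Measurable (Function.uncurry X))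
    (hX_stat : HasStationaryIncrements X P) (hX_gauss : IsGaussianProcess X P)
    (hψ : IsWavelet ψ) (t : ℝ) (k : ℤ) :
    MemLp (fun ω => waveletTransform ψ (fun u => X u ω) t k) 2 P := by
  rw [hψ.waveletTransform_eq_pathIntegral]
  exact (meanSquareIntegrable_atom hX hX_stat hX_gauss hψ t k).memLp_pathIntegral

theorem indepFun_waveletTransform (hX : Measurable (Function.uncurry X))
    (hX_stat : HasStationaryIncrements X P) (hX_gauss : IsGaussianProcess X P)
    (hψ : IsWavelet ψ) (hψ_pos : PositiveFrequencies ψ) {j k : ℤ}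
    (h_disjoint : ∀ ω : ℝ, hat (dilate ψ j) ω * hat (dilate ψ k) ω = 0) (t s : ℝ) :
    IndepFun (fun ω => waveletTransform ψ (fun u => X u ω) t j)
      (fun ω => waveletTransform ψ (fun u => X u ω) s k) P := by
  rw [hψ.waveletTransform_eq_pathIntegral, hψ.waveletTransform_eq_pathIntegral]
  exact indepFun_pathIntegral
    (hX_stat.hasHomogeneousIncrements_started fun _ => hX.comp measurable_prodMk_left)
    (measurable_uncurry_started hX) (isGaussianProcess_started hX_gauss)
    (hψ.hasFirstMoment_atom t j) (hψ.hasFirstMoment_atom s k) (hψ.integral_atom t j)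
    (hψ.integral_atom s k) (fourier_atom_mul_fourier_atom h_disjoint s t)
    (fourier_atom_mul_fourier_atom_neg hψ hψ_pos j k s t)

theorem covMatrix_rhoW_eq_zero (hX : Measurable (Function.uncurry X))
    (hX_stat : HasStationaryIncrements X P) (hX_gauss : IsGaussianProcess X P)
    (hψ : IsWavelet ψ) (hψ_pos : PositiveFrequencies ψ) {j k : ℤ}
    (h_disjoint : ∀ ω : ℝ, hat (dilate ψ j) ω * hat (dilate ψ k) ω = 0) (t s : ℝ) :
    covMatrix P (rhoW ψ X t j) (rhoW ψ X s k) = 0 := by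
  have h_meas (t : ℝ) (k : ℤ) : AEMeasurable (rhoW ψ X t k) P :=
    measurable_rho.comp_aemeasurable
      (memLp_waveletTransform hX hX_stat hX_gauss hψ t k).aestronglyMeasurable.aemeasurable
  exact covMatrix_eq_zero_of_indepFun
    ((indepFun_waveletTransform hX hX_stat hX_gauss hψ hψ_pos h_disjoint t s).comp
      measurable_rho measurable_rho) (h_meas t j) (h_meas s k)

end Gaussian

end WaveletCov

theorem mainTheorem4 {Ω : Type*} [MeasurableSpace Ω] (P : Measure Ω) [IsProbabilityMeasure P]
    (X : ℝ → Ω → ℝ) (hX : Measurable (Function.uncurry X))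
    (hstat : WaveletCov.HasStationaryIncrements X P)
    (ψ : ℝ → ℂ) (hψ : WaveletCov.IsWavelet ψ) (hpos : WaveletCov.PositiveFrequencies ψ)
    (j a : ℤ)
    (hdisj : ∀ ω : ℝ, WaveletCov.hat (WaveletCov.dilate ψ j) ω * WaveletCov.hat (WaveletCov.dilate ψ (j - a)) ω = 0) :
    (IsGaussianProcess X P →
      -- the wavelet coefficients are almost surely convergent integrals with finite second moment
      (∀ (t : ℝ) (k : ℤ),
        (∀ᵐ ω ∂P, Integrable (fun u : ℝ => (X u ω : ℂ) * WaveletCov.dilate ψ k (t - u))) ∧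
        (∀ p : Fin 2, MemLp (fun ω => WaveletCov.rhoW ψ X t k ω p) 2 P)) ∧
      (∀ t τ : ℝ,
        WaveletCov.covMatrix P (WaveletCov.rhoW ψ X t j)
          (WaveletCov.rhoW ψ X (t - (2 : ℝ) ^ j * τ) (j - a)) = 0)) ∧
    ((∃ (t τ : ℝ) (p q : Fin 2),
        WaveletCov.covMatrix P (WaveletCov.rhoW ψ X t j)
          (WaveletCov.rhoW ψ X (t - (2 : ℝ) ^ j * τ) (j - a)) p q ≠ 0) →
      ¬ IsGaussianProcess X P) := by
  have h_cov (hG : IsGaussianProcess X P) (t τ : ℝ) :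
      WaveletCov.covMatrix P (WaveletCov.rhoW ψ X t j)
        (WaveletCov.rhoW ψ X (t - (2 : ℝ) ^ j * τ) (j - a)) = 0 :=
    WaveletCov.covMatrix_rhoW_eq_zero hX hstat hG hψ hpos hdisj t _
  refine ⟨fun hG => ⟨fun t k => ⟨WaveletCov.ae_integrable_waveletTransform hX hstat hG hψ t k,
    WaveletCov.memLp_rhoW (WaveletCov.memLp_waveletTransform hX hstat hG hψ t k)⟩, h_cov hG⟩, ?_⟩
  rintro ⟨t, τ, p, q, h_ne⟩ hG
  exact h_ne (by rw [h_cov hG t τ, Matrix.zero_apply])
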